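/- Consider the Brockett–Heisenberg system on $[0,1]$, $$\dot x=u,\qquad \dot y=v,\qquad \dot z=vx-uy,\qquad x(0)=y(0)=z(0)=0,$$ with output $z(1)$ (solutions are absolutely continuous functions satisfying the equations almost everywhere). Let $$\mathcal B_0=\{\sqrt2\sin(2\pi t),\ \sqrt2\cos(2\pi t),\ \sqrt2\sin(4\pi t),\ \sqrt2\cos(4\pi t),\dots\}\subset L^2[0,1],$$ and let $\mathcal L\subset L^2[0,1]$ be the space of functions represented by a Fourier series in the elements of $\mathcal B_0$ (no constant term) with square-summable real coefficients. Let $m,n\ge 1$ and let $H$ be a real $m\times n$ matrix with singular values $\sigma_1(H)\ge\sigma_2(H)\ge\cdots$. Controls $u_1,\dots,u_m$ and $v_1,\dots,v_n$ realize $H$ in a single round if, for all $i,j$, the output of the system under the input pair $(u_i,v_j)$ is $z(1)=H_{ij}$; their cost is $$\frac1m\sum_{i=1}^m\int_0^1u_i(t)^2\,dt+\frac1n\sum_{j=1}^n\int_0^1v_j(t)^2\,dt .$$ Then the infimum of the cost over all $u_1,\dots,u_m,v_1,\dots,v_n\in\mathcal L$ that realize $H$ in a single round is $$\frac{2\pi}{\sqrt{mn}}\sum_{k=1}^{\min(m,n)}\Big\lceil\frac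 k2\Big\rceil\,\sigma_k(H),$$ and it is attained, by controls $u_i,v_j$ that lie in the linear span of $\mathcal B_0$. -/

import Mathlib

open MeasureTheory Set

namespace BrockettHeisenberg

/-- Lebesgue measure on the control interval `[0, 1]`. -/
noncomputable abbrev unitMeasure : Measure ℝ := volume.restrict (Icc (0 : ℝ) 1)

/-- The real Hilbert space `L²[0, 1]`. -/
abbrev L2 : Type := Lp ℝ 2 unitMeasure

/-- `x, y, z` is the (Carathéodory) solution on `[0, 1]` of the Brockett-Heisenberg system
`x' = u, y' = v, z' = v x - u y`, `x(0) = y(0) = z(0) = 0`: the three functions are absolutely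
continuous and the differential equations hold almost everywhere. -/
structure IsTrajectory (u v x y z : ℝ → ℝ) : Prop where
  x_ac : AbsolutelyContinuousOnInterval x 0 1
  y_ac : AbsolutelyContinuousOnInterval y 0 1
  z_ac : AbsolutelyContinuousOnInterval z 0 1
  x_zero : x 0 = 0
  y_zero : y 0 = 0
  z_zero : z 0 = 0
  x_deriv : ∀ᵐ t ∂unitMeasure, HasDerivAt x (u t) t
  y_deriv : ∀ᵐ t ∂unitMeasure, HasDerivAt y (v t) t
  z_deriv : ∀ᵐ t ∂unitMeasure, HasDerivAt z (v t * x t - u t * y t) t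

/-- The trigonometric functions
`√2 sin(2πt), √2 cos(2πt), √2 sin(4πt), √2 cos(4πt), …`, numbered from `0`. -/
noncomputable def trigFun (j : ℕ) (t : ℝ) : ℝ :=
  if Even j then √2 * Real.sin (2 * Real.pi * ((j / 2 + 1 : ℕ) : ℝ) * t)
  else √2 * Real.cos (2 * Real.pi * ((j / 2 + 1 : ℕ) : ℝ) * t)

theorem memLp_trigFun (j : ℕ) : MemLp (trigFun j) 2 unitMeasure := by
  have hc : Continuous (trigFun j) := by
    unfold trigFun
    split_ifs <;> fun_prop
  refine MemLp.of_bound hc.aestronglyMeasurable (√2) (Filter.Eventually.of_forall fun t => ?_)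
  have h2 : (0 : ℝ) ≤ √2 := Real.sqrt_nonneg 2
  unfold trigFun
  split_ifs
  · rw [norm_mul, Real.norm_of_nonneg h2]
    exact mul_le_of_le_one_right h2 (Real.abs_sin_le_one _)
  · rw [norm_mul, Real.norm_of_nonneg h2]
    exact mul_le_of_le_one_right h2 (Real.abs_cos_le_one _)

/-- The trigonometric basis `B₀` as a family of elements of `L²[0, 1]`. -/
noncomputable def trigBasis (j : ℕ) : L2 := (memLp_trigFun j).toLp (trigFun j)

/-- The space of admissible controls: the elements of `L²[0, 1]` that are represented by a
Fourier series in the functions of `B₀` (no constant term) with square summable coefficients. -/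
def admissible : Set L2 :=
  {f | ∃ a : ℕ → ℝ, Summable (fun j => a j ^ 2) ∧ HasSum (fun j => a j • trigBasis j) f}

/-- The controls `u₁, …, uₘ` of Alice and `v₁, …, vₙ` of Bob realize the target `H` in a single
round: under the pair `(uᵢ, vⱼ)` the output at time `1` is `Hᵢⱼ`. -/
def Realizes {m n : ℕ} (U : Fin m → L2) (V : Fin n → L2) (H : Matrix (Fin m) (Fin n) ℝ) : Prop :=
  ∀ i j, ∃ x y z : ℝ → ℝ, IsTrajectory (U i) (V j) x y z ∧ z 1 = H i j

/-- The control cost: the average energy of Alice's controls plus that of Bob's controls. -/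
noncomputable def controlCost {m n : ℕ} (U : Fin m → L2) (V : Fin n → L2) : ℝ :=
  (1 / (m : ℝ)) * ∑ i, (∫ t in (0 : ℝ)..1, (U i t) ^ 2) +
    (1 / (n : ℝ)) * ∑ j, (∫ t in (0 : ℝ)..1, (V j t) ^ 2)

/-- The `k`-th largest singular value of `H`, numbered from `k = 1`. -/
noncomputable def sigma {m n : ℕ} (H : Matrix (Fin m) (Fin n) ℝ) (k : ℕ) : ℝ :=
  (Matrix.toEuclideanLin H).singularValues (k - 1)

/-- The costs of all single round protocols with admissible controls that realize `H`. -/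
def costSet {m n : ℕ} (H : Matrix (Fin m) (Fin n) ℝ) : Set ℝ :=
  {c | ∃ (U : Fin m → L2) (V : Fin n → L2),
    (∀ i, U i ∈ admissible) ∧ (∀ j, V j ∈ admissible) ∧ Realizes U V H ∧ c = controlCost U V}

end BrockettHeisenberg

/-! Admissible controls have mean zero, so `x` closes up and `z(1) = 2∫ x v`. Integrating by parts
against the sines and cosines turns this into a bilinear form in the Fourier coefficients
(`IsTrajectory.hasSum_output`): frequency `f` enters with weight `1/(πf)` and couples the sine
coefficient of one control to the cosine coefficient of the other. Realizing `H` thus means `H = ∑ₗ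
(π fₗ)⁻¹ uₗ vₗᵀ` with `f = 1, 1, 2, 2, …`. By Parseval the cost is `∑ₗ (‖uₗ‖²/m + ‖vₗ‖²/n)`, which
AM-GM bounds below by `2/√(mn) · ∑ₗ ‖uₗ‖‖vₗ‖`.

Lower bound (`weighted_sum_singularValues_le`): for each `t`, take a contraction annihilating the
span of the first `2t` vectors `vₗ`. Its pairing with `H` is at least the tail of singular values
past the first `2t` (`exists_contraction`), and at most `∑_{l ≥ 2t} (π fₗ)⁻¹ ‖uₗ‖‖vₗ‖`. Summing over
`t` counts the index `l` exactly `fₗ` times: this cancels the weight on one side and produces `fₖ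
σₖ` on the other.

Attainment (`exists_optimal`): put the singular pairs of `H`, in decreasing order, on the successive
modes, scaled so that AM-GM is an equality. -/

namespace BrockettHeisenberg

/-! ### Calculus of the trigonometric functions -/

/-- The angular frequency index `1, 1, 2, 2, …` of the trigonometric basis. -/
def freq (j : ℕ) : ℕ := j / 2 + 1

/-- The involution of `ℕ` that exchanges the sine and the cosine of the same frequency. -/
def partner (j : ℕ) : ℕ := if Even j then j + 1 else j - 1

/-- The sign in `(sin)' = cos`, `(cos)' = -sin`. -/
noncomputable def derivSign (j : ℕ) : ℝ := if Even j then 1 else -1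

theorem partner_partner (j : ℕ) : partner (partner j) = j := by
  unfold partner; grind

theorem freq_partner (j : ℕ) : freq (partner j) = freq j := by
  unfold partner freq; grind

theorem derivSign_partner (j : ℕ) : derivSign (partner j) = -derivSign j := by
  by_cases h : Even j
  · simp [partner, derivSign, h, Nat.even_add_one]
  · have : Even (j - 1) := by grind
    simp [partner, derivSign, h, this]

theorem derivSign_sq (j : ℕ) : derivSign j ^ 2 = 1 := by
  unfold derivSign; split_ifs <;> norm_num

theorem freq_pos (j : ℕ) : (0 : ℝ) < freq j := by
  unfold freq; positivity

theorem hasDerivAt_trigFun (j : ℕ) (t : ℝ) :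
    HasDerivAt (trigFun j) (derivSign j * (2 * Real.pi * freq j) * trigFun (partner j) t) t := by
  have hid : HasDerivAt (fun t : ℝ => 2 * Real.pi * ((j / 2 + 1 : ℕ) : ℝ) * t)
      (2 * Real.pi * ((j / 2 + 1 : ℕ) : ℝ)) t := by
    simpa using (hasDerivAt_id t).const_mul (2 * Real.pi * ((j / 2 + 1 : ℕ) : ℝ))
  by_cases h : Even j
  · have e : trigFun j = fun t => √2 * Real.sin (2 * Real.pi * ((j / 2 + 1 : ℕ) : ℝ) * t) := by
      ext t; simp only [trigFun, h, if_true]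
    have h1 : ¬ Even (j + 1) := by grind
    have h2 : (j + 1) / 2 = j / 2 := by grind
    rw [e]
    refine (hid.sin.const_mul (√2)).congr_deriv ?_
    simp only [derivSign, partner, freq, trigFun, h, h1, h2, if_true, if_false]
    ring
  · have e : trigFun j = fun t => √2 * Real.cos (2 * Real.pi * ((j / 2 + 1 : ℕ) : ℝ) * t) := by
      ext t; simp only [trigFun, h, if_false]
    have h1 : Even (j - 1) := by grind
    have h2 : (j - 1) / 2 = j / 2 := by grind
    rw [e]
    refine (hid.cos.const_mul (√2)).congr_deriv ?_
    simp only [derivSign, partner, freq, trigFun, h, h1, h2, if_true, if_false]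
    ring

theorem trigFun_one (j : ℕ) : trigFun j 1 = trigFun j 0 := by
  have hs := Real.sin_nat_mul_pi (2 * (j / 2 + 1))
  have hc := Real.cos_nat_mul_two_pi (j / 2 + 1)
  unfold trigFun
  have e : 2 * Real.pi * ((j / 2 + 1 : ℕ) : ℝ) * 1 = ((j / 2 + 1 : ℕ) : ℝ) * (2 * Real.pi) := by ring
  have e' : 2 * Real.pi * ((j / 2 + 1 : ℕ) : ℝ) * 1 = ((2 * (j / 2 + 1) : ℕ) : ℝ) * Real.pi := by
    push_cast; ring
  split_ifs
  · rw [e', hs]; simp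
  · rw [e, hc]; simp

/-- The antiderivative of a trigonometric basis function. -/
theorem trigFun_eq_deriv (j : ℕ) (t : ℝ) :
    trigFun j t = deriv (fun t => -derivSign j / (2 * Real.pi * freq j) * trigFun (partner j) t) t := by
  have h := ((hasDerivAt_trigFun (partner j) t).const_mul (-derivSign j / (2 * Real.pi * freq j))).deriv
  rw [h, derivSign_partner, freq_partner, partner_partner]
  have := freq_pos j
  have := Real.pi_pos
  field_simp
  rw [derivSign_sq, mul_one]

theorem absolutelyContinuous_trigFun (j : ℕ) : AbsolutelyContinuousOnInterval (trigFun j) 0 1 := by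
  refine ContDiffOn.absolutelyContinuousOnInterval (ContDiff.contDiffOn ?_)
  unfold trigFun
  split_ifs <;> fun_prop

/-- Integration by parts against a trigonometric basis function. -/
theorem integral_trigFun_mul {x : ℝ → ℝ} (hx : AbsolutelyContinuousOnInterval x 0 1)
    (h01 : x 1 = x 0) (j : ℕ) :
    ∫ t in (0 : ℝ)..1, x t * trigFun j t =
      derivSign j / (2 * Real.pi * freq j) * ∫ t in (0 : ℝ)..1, deriv x t * trigFun (partner j) t := by
  have h := hx.integral_mul_deriv_eq_deriv_mul
    ((absolutelyContinuous_trigFun (partner j)).const_mul (-derivSign j / (2 * Real.pi * freq j)))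
  simp_rw [← trigFun_eq_deriv] at h
  -- The boundary term vanishes because both factors take equal values at `0` and `1`.
  rw [h, h01, trigFun_one, sub_self, zero_sub, ← intervalIntegral.integral_const_mul,
    ← intervalIntegral.integral_neg]
  congr 1
  ext t
  ring

theorem integral_trigFun (j : ℕ) : ∫ t in (0 : ℝ)..1, trigFun j t = 0 := by
  have h := integral_trigFun_mul (x := fun _ => 1)
    (LipschitzWith.const (1 : ℝ)).lipschitzOnWith.absolutelyContinuousOnInterval rfl j
  simpa using h

/-! ### Orthonormality and Fourier coefficients in `L²[0, 1]` -/

theorem ae_unitMeasure_iff {p : ℝ → Prop} :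
    (∀ᵐ t ∂unitMeasure, p t) ↔ ∀ᵐ t ∂(volume : Measure ℝ), t ∈ Icc (0 : ℝ) 1 → p t :=
  ae_restrict_iff' measurableSet_Icc

theorem integral_unitMeasure (f : ℝ → ℝ) : ∫ t, f t ∂unitMeasure = ∫ t in (0 : ℝ)..1, f t := by
  rw [intervalIntegral.integral_of_le zero_le_one, integral_Icc_eq_integral_Ioc]

theorem intervalIntegral_congr_unitMeasure {f g : ℝ → ℝ} (h : ∀ᵐ t ∂unitMeasure, f t = g t) :
    ∫ t in (0 : ℝ)..1, f t = ∫ t in (0 : ℝ)..1, g t := by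
  rw [← integral_unitMeasure, ← integral_unitMeasure]
  exact integral_congr_ae h

theorem inner_eq_integral (f g : L2) : inner ℝ f g = ∫ t in (0 : ℝ)..1, f t * g t := by
  rw [MeasureTheory.L2.inner_def, integral_unitMeasure]
  simp [mul_comm]

theorem coeFn_trigBasis (j : ℕ) : ∀ᵐ t ∂unitMeasure, trigBasis j t = trigFun j t :=
  (memLp_trigFun j).coeFn_toLp

theorem inner_trigBasis (f : L2) (j : ℕ) :
    inner ℝ f (trigBasis j) = ∫ t in (0 : ℝ)..1, f t * trigFun j t := by
  rw [inner_eq_integral]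
  refine intervalIntegral_congr_unitMeasure ?_
  filter_upwards [coeFn_trigBasis j] with t ht
  rw [ht]

theorem integral_cos_int (k : ℤ) :
    ∫ t in (0 : ℝ)..1, Real.cos (2 * Real.pi * k * t) = if k = 0 then 1 else 0 := by
  split_ifs with h
  · simp [h]
  · have hk : (2 * Real.pi * k : ℝ) ≠ 0 := by
      have := Real.pi_pos; have : (k : ℝ) ≠ 0 := by exact_mod_cast h
      positivity
    rw [intervalIntegral.integral_comp_mul_left (fun t => Real.cos t) hk]
    have : Real.sin (2 * Real.pi * k) = 0 := by
      have := Real.sin_int_mul_pi (2 * k)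
      rw [← this]; push_cast; ring_nf
    simp [this]

theorem integral_sin_int (k : ℤ) :
    ∫ t in (0 : ℝ)..1, Real.sin (2 * Real.pi * k * t) = 0 := by
  by_cases h : k = 0
  · simp [h]
  · have hk : (2 * Real.pi * k : ℝ) ≠ 0 := by
      have := Real.pi_pos; have : (k : ℝ) ≠ 0 := by exact_mod_cast h
      positivity
    rw [intervalIntegral.integral_comp_mul_left (fun t => Real.sin t) hk]
    have : Real.cos (2 * Real.pi * k) = 1 := by
      have := Real.cos_int_mul_two_pi k
      rw [← this]; ring_nf
    simp [this]

theorem integral_trigFun_mul_trigFun (i j : ℕ) :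
    ∫ t in (0 : ℝ)..1, trigFun i t * trigFun j t = if i = j then 1 else 0 := by
  have h2 : √2 * √2 = (2 : ℝ) := Real.mul_self_sqrt (by norm_num)
  set p : ℤ := ((i / 2 + 1 : ℕ) : ℤ) with hp
  set q : ℤ := ((j / 2 + 1 : ℕ) : ℤ) with hq
  have hpq : p + q ≠ 0 := by omega
  have ci : ∀ k : ℤ, IntervalIntegrable (fun t : ℝ => Real.cos (2 * Real.pi * k * t)) volume 0 1 :=
    fun k => Continuous.intervalIntegrable (by fun_prop) _ _
  have si : ∀ k : ℤ, IntervalIntegrable (fun t : ℝ => Real.sin (2 * Real.pi * k * t)) volume 0 1 :=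
    fun k => Continuous.intervalIntegrable (by fun_prop) _ _
  have ep : ((i / 2 + 1 : ℕ) : ℝ) = (p : ℝ) := by rw [hp, Int.cast_natCast]
  have eq : ((j / 2 + 1 : ℕ) : ℝ) = (q : ℝ) := by rw [hq, Int.cast_natCast]
  unfold trigFun
  rw [ep, eq]
  by_cases hi : Even i <;> by_cases hj : Even j <;> simp only [hi, hj, if_true, if_false]
  · have e : ∀ t : ℝ, √2 * Real.sin (2 * Real.pi * p * t) * (√2 * Real.sin (2 * Real.pi * q * t)) =
        Real.cos (2 * Real.pi * (p - q : ℤ) * t) - Real.cos (2 * Real.pi * (p + q : ℤ) * t) := by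
      intro t
      push_cast
      rw [show 2 * Real.pi * ((p : ℝ) - q) * t = 2 * Real.pi * p * t - 2 * Real.pi * q * t by ring,
        show 2 * Real.pi * ((p : ℝ) + q) * t = 2 * Real.pi * p * t + 2 * Real.pi * q * t by ring,
        Real.cos_sub, Real.cos_add]
      linear_combination (Real.sin (2 * Real.pi * p * t) * Real.sin (2 * Real.pi * q * t)) * h2
    simp_rw [e]
    rw [intervalIntegral.integral_sub (ci _) (ci _), integral_cos_int, integral_cos_int, if_neg hpq,
      sub_zero]
    exact if_congr (by grind) rfl rfl
  · have e : ∀ t : ℝ, √2 * Real.sin (2 * Real.pi * p * t) * (√2 * Real.cos (2 * Real.pi * q * t)) =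
        Real.sin (2 * Real.pi * (p - q : ℤ) * t) + Real.sin (2 * Real.pi * (p + q : ℤ) * t) := by
      intro t
      push_cast
      rw [show 2 * Real.pi * ((p : ℝ) - q) * t = 2 * Real.pi * p * t - 2 * Real.pi * q * t by ring,
        show 2 * Real.pi * ((p : ℝ) + q) * t = 2 * Real.pi * p * t + 2 * Real.pi * q * t by ring,
        Real.sin_sub, Real.sin_add]
      linear_combination (Real.sin (2 * Real.pi * p * t) * Real.cos (2 * Real.pi * q * t)) * h2
    simp_rw [e]
    rw [intervalIntegral.integral_add (si _) (si _), integral_sin_int, integral_sin_int, if_neg (by grind),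
      add_zero]
  · have e : ∀ t : ℝ, √2 * Real.cos (2 * Real.pi * p * t) * (√2 * Real.sin (2 * Real.pi * q * t)) =
        Real.sin (2 * Real.pi * (p + q : ℤ) * t) - Real.sin (2 * Real.pi * (p - q : ℤ) * t) := by
      intro t
      push_cast
      rw [show 2 * Real.pi * ((p : ℝ) - q) * t = 2 * Real.pi * p * t - 2 * Real.pi * q * t by ring,
        show 2 * Real.pi * ((p : ℝ) + q) * t = 2 * Real.pi * p * t + 2 * Real.pi * q * t by ring,
        Real.sin_sub, Real.sin_add]
      linear_combination (Real.cos (2 * Real.pi * p * t) * Real.sin (2 * Real.pi * q * t)) * h2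
    simp_rw [e]
    rw [intervalIntegral.integral_sub (si _) (si _), integral_sin_int, integral_sin_int, if_neg (by grind),
      sub_zero]
  · have e : ∀ t : ℝ, √2 * Real.cos (2 * Real.pi * p * t) * (√2 * Real.cos (2 * Real.pi * q * t)) =
        Real.cos (2 * Real.pi * (p - q : ℤ) * t) + Real.cos (2 * Real.pi * (p + q : ℤ) * t) := by
      intro t
      push_cast
      rw [show 2 * Real.pi * ((p : ℝ) - q) * t = 2 * Real.pi * p * t - 2 * Real.pi * q * t by ring,
        show 2 * Real.pi * ((p : ℝ) + q) * t = 2 * Real.pi * p * t + 2 * Real.pi * q * t by ring,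
        Real.cos_sub, Real.cos_add]
      linear_combination (Real.cos (2 * Real.pi * p * t) * Real.cos (2 * Real.pi * q * t)) * h2
    simp_rw [e]
    rw [intervalIntegral.integral_add (ci _) (ci _), integral_cos_int, integral_cos_int, if_neg hpq,
      add_zero]
    exact if_congr (by grind) rfl rfl

theorem orthonormal_trigBasis : Orthonormal ℝ trigBasis := by
  rw [orthonormal_iff_ite]
  intro i j
  rw [inner_trigBasis, ← integral_trigFun_mul_trigFun i j]
  refine intervalIntegral_congr_unitMeasure ?_
  filter_upwards [coeFn_trigBasis i] with t ht
  rw [ht]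

/-- The coefficient of an `L²` convergent expansion is the inner product. -/
theorem inner_trigBasis_of_hasSum {f : L2} {a : ℕ → ℝ} (h : HasSum (fun j => a j • trigBasis j) f)
    (j : ℕ) : inner ℝ f (trigBasis j) = a j := by
  have h1 := h.mapL (innerSL ℝ (trigBasis j))
  have h2 : ∀ k, innerSL ℝ (trigBasis j) (a k • trigBasis k) = if k = j then a j else 0 := by
    intro k
    rw [innerSL_apply_apply, inner_smul_right, orthonormal_iff_ite.1 orthonormal_trigBasis j k]
    by_cases e : k = j
    · simp [e]
    · simp [e, Ne.symm e]
  simp_rw [h2] at h1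
  have h3 := h1.unique (hasSum_ite_eq j (a j))
  rw [real_inner_comm]
  exact h3

/-- Parseval's identity, obtained by pairing the expansion of `f` with `f` itself. -/
theorem hasSum_energy {f : L2} {a : ℕ → ℝ} (h : HasSum (fun j => a j • trigBasis j) f) :
    HasSum (fun j => a j ^ 2) (∫ t in (0 : ℝ)..1, (f t) ^ 2) := by
  have h1 := h.mapL (innerSL ℝ f)
  simp only [innerSL_apply_apply, inner_smul_right, inner_trigBasis_of_hasSum h] at h1
  simp_rw [pow_two, ← inner_eq_integral]
  exact h1

theorem integral_eq_zero_of_hasSum {f : L2} {a : ℕ → ℝ}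
    (h : HasSum (fun j => a j • trigBasis j) f) : ∫ t in (0 : ℝ)..1, f t = 0 := by
  have hone : MemLp (fun _ : ℝ => (1 : ℝ)) 2 unitMeasure := memLp_const 1
  have key : ∀ g : L2, inner ℝ (hone.toLp _) g = ∫ t in (0 : ℝ)..1, g t := by
    intro g
    rw [inner_eq_integral]
    refine intervalIntegral_congr_unitMeasure ?_
    filter_upwards [hone.coeFn_toLp] with t ht
    rw [ht, one_mul]
  have h1 := h.mapL (innerSL ℝ (hone.toLp _))
  have h2 : ∀ k, innerSL ℝ (hone.toLp _) (a k • trigBasis k) = 0 := by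
    intro k
    rw [innerSL_apply_apply, inner_smul_right, key,
      intervalIntegral_congr_unitMeasure (coeFn_trigBasis k), integral_trigFun, mul_zero]
  simp_rw [h2] at h1
  rw [← key]
  exact h1.unique hasSum_zero

/-! ### The output as a bilinear form in Fourier coefficients -/

theorem IsTrajectory.x_one {u v x y z : ℝ → ℝ} (h : IsTrajectory u v x y z) :
    x 1 = ∫ t in (0 : ℝ)..1, u t := by
  have h1 := h.x_ac.integral_deriv_eq_sub
  rw [h.x_zero, sub_zero] at h1
  rw [← h1]
  refine intervalIntegral_congr_unitMeasure ?_
  filter_upwards [h.x_deriv] with t ht using ht.deriv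

/-- Since `x` vanishes at both ends, `∫ (x y)' = 0`; adding this to `∫ z'` cancels `u y` and doubles
`v x`. The endpoint `y 1` plays no role. -/
theorem IsTrajectory.output_eq {u v x y z : ℝ → ℝ} (h : IsTrajectory u v x y z) (hx : x 1 = 0) :
    z 1 = 2 * ∫ t in (0 : ℝ)..1, x t * v t := by
  have h1 := h.z_ac.integral_deriv_eq_sub
  rw [h.z_zero, sub_zero] at h1
  have h2 := h.x_ac.integral_deriv_mul_eq_sub h.y_ac
  rw [hx, h.x_zero, zero_mul, zero_mul, sub_zero] at h2
  have h3 : z 1 = (∫ t in (0 : ℝ)..1, deriv z t) +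
      ∫ t in (0 : ℝ)..1, deriv x t * y t + x t * deriv y t := by rw [h1, h2, add_zero]
  rw [h3, ← intervalIntegral.integral_add,
    ← intervalIntegral.integral_const_mul]
  · refine intervalIntegral_congr_unitMeasure ?_
    filter_upwards [h.x_deriv, h.y_deriv, h.z_deriv] with t htx hty htz
    rw [htx.deriv, hty.deriv, htz.deriv]
    ring
  · exact h.z_ac.intervalIntegrable_deriv
  · exact (h.x_ac.intervalIntegrable_deriv.mul_continuousOn h.y_ac.continuousOn).add
      (h.y_ac.intervalIntegrable_deriv.continuousOn_mul h.x_ac.continuousOn)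

/-- The output of the system in terms of the Fourier coefficients of the controls. -/
theorem IsTrajectory.hasSum_output {f g : L2} {x y z : ℝ → ℝ} (h : IsTrajectory f g x y z)
    {a b : ℕ → ℝ} (hf : HasSum (fun j => a j • trigBasis j) f)
    (hg : HasSum (fun j => b j • trigBasis j) g) :
    HasSum (fun j => 1 / (Real.pi * freq j) * (derivSign j * a (partner j) * b j)) (z 1) := by
  have hx1 : x 1 = 0 := by rw [h.x_one, integral_eq_zero_of_hasSum hf]
  have hxm : MemLp x 2 unitMeasure := by
    have hc := h.x_ac.continuousOn
    rw [uIcc_of_le zero_le_one] at hc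
    obtain ⟨C, hC⟩ := h.x_ac.exists_bound
    rw [uIcc_of_le zero_le_one] at hC
    exact MemLp.of_bound (hc.aestronglyMeasurable measurableSet_Icc) C
      ((ae_restrict_iff' measurableSet_Icc).2 (Filter.Eventually.of_forall hC))
  have key : ∀ k : L2, inner ℝ (hxm.toLp x) k = ∫ t in (0 : ℝ)..1, x t * k t := by
    intro k
    rw [inner_eq_integral]
    refine intervalIntegral_congr_unitMeasure ?_
    filter_upwards [hxm.coeFn_toLp] with t ht
    rw [ht]
  rw [h.output_eq hx1, ← key]
  -- Pairing with `x` is continuous on `L²`, so the series of `g` may be integrated term by term.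
  have h1 := (hg.mapL (innerSL ℝ (hxm.toLp x))).mul_left 2
  refine h1.congr_fun ?_
  intro j
  have h2 : ∫ t in (0 : ℝ)..1, x t * trigBasis j t = ∫ t in (0 : ℝ)..1, x t * trigFun j t := by
    refine intervalIntegral_congr_unitMeasure ?_
    filter_upwards [coeFn_trigBasis j] with t ht
    rw [ht]
  have h3 : ∫ t in (0 : ℝ)..1, deriv x t * trigFun (partner j) t = a (partner j) := by
    rw [← inner_trigBasis_of_hasSum hf, inner_trigBasis]
    refine intervalIntegral_congr_unitMeasure ?_
    filter_upwards [h.x_deriv] with t ht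
    rw [ht.deriv]
  rw [innerSL_apply_apply, inner_smul_right, key, h2,
    integral_trigFun_mul h.x_ac (hx1.trans h.x_zero.symm), h3]
  have := freq_pos j
  have := Real.pi_pos
  field_simp

theorem intervalIntegrable_coeFn (f : L2) : IntervalIntegrable f volume 0 1 := by
  rw [intervalIntegrable_iff_integrableOn_Icc_of_le zero_le_one]
  exact (Lp.memLp f).integrable (by norm_num)

theorem ae_hasDerivAt_primitive {w : ℝ → ℝ} (hw : IntervalIntegrable w volume 0 1) :
    ∀ᵐ t ∂unitMeasure, HasDerivAt (fun t => ∫ s in (0 : ℝ)..t, w s) (w t) t := by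
  rw [ae_unitMeasure_iff]
  filter_upwards [hw.ae_hasDerivAt_integral] with t ht hmem
  rw [uIcc_of_le zero_le_one] at ht
  exact ht hmem 0 (by simp)

/-- Iterated primitives of the controls solve the system; attainment needs this, because `Realizes`
demands that a trajectory exist. -/
theorem exists_isTrajectory (f g : L2) : ∃ x y z : ℝ → ℝ, IsTrajectory f g x y z := by
  have hf := intervalIntegrable_coeFn f
  have hg := intervalIntegrable_coeFn g
  have h0 : (0 : ℝ) ∈ uIcc (0 : ℝ) 1 := by simp
  have hx := hf.absolutelyContinuousOnInterval_intervalIntegral h0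
  have hy := hg.absolutelyContinuousOnInterval_intervalIntegral h0
  have hz : IntervalIntegrable (fun t => g t * (∫ s in (0 : ℝ)..t, f s) -
      f t * (∫ s in (0 : ℝ)..t, g s)) volume 0 1 :=
    (hg.mul_continuousOn hx.continuousOn).sub (hf.mul_continuousOn hy.continuousOn)
  exact ⟨_, _, _, hx, hy, hz.absolutelyContinuousOnInterval_intervalIntegral h0, by simp, by simp,
    by simp, ae_hasDerivAt_primitive hf, ae_hasDerivAt_primitive hg, ae_hasDerivAt_primitive hz⟩

/-! ### Singular values and contractions -/

/-- A singular value decomposition `T qₖ = σₖ pₖ`, with `pₖ = 0` where `σₖ = 0`. -/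
theorem exists_singular_basis {E F : Type*} [NormedAddCommGroup E] [InnerProductSpace ℝ E]
    [FiniteDimensional ℝ E] [NormedAddCommGroup F] [InnerProductSpace ℝ F] [FiniteDimensional ℝ F]
    {n : ℕ} (hn : Module.finrank ℝ E = n) (T : E →ₗ[ℝ] F) :
    ∃ (q : OrthonormalBasis (Fin n) ℝ E) (p : Fin n → F),
      (∀ k, T (q k) = T.singularValues k • p k) ∧
      (∀ k w, inner ℝ (p k) (T w) = T.singularValues k * inner ℝ (q k) w) ∧
      (∀ k : Fin n, T.singularValues k = 0 → p k = 0) ∧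
      (Orthonormal ℝ fun k : {k : Fin n // T.singularValues k ≠ 0} => p k) := by
  set q := T.isSymmetric_adjoint_comp_self.eigenvectorBasis hn with hq
  have hTT : ∀ k, LinearMap.adjoint T (T (q k)) = (T.singularValues k ^ 2) • q k := by
    intro k
    have := T.isSymmetric_adjoint_comp_self.apply_eigenvectorBasis hn k
    rw [← T.sq_singularValues_fin hn] at this
    exact this
  have hin : ∀ k w, inner ℝ (T (q k)) (T w) = T.singularValues k ^ 2 * inner ℝ (q k) w := by
    intro k w
    rw [← LinearMap.adjoint_inner_left, hTT, real_inner_smul_left]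
  -- The convention `0⁻¹ = 0` makes this vector zero exactly where normalization is impossible.
  refine ⟨q, fun k => (T.singularValues k)⁻¹ • T (q k), ?_, ?_, ?_, ?_⟩
  · intro k
    by_cases h : T.singularValues k = 0
    · have := hin k (q k)
      rw [h] at this
      rw [h, zero_smul, ← inner_self_eq_zero (𝕜 := ℝ), this]
      simp
    · rw [smul_smul, mul_inv_cancel₀ h, one_smul]
  · intro k w
    rw [real_inner_smul_left, hin]
    by_cases h : T.singularValues k = 0
    · simp [h]
    · field_simp
  · intro k h
    simp [h]
  · rw [orthonormal_iff_ite]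
    rintro ⟨k, hk⟩ ⟨l, hl⟩
    simp only [real_inner_smul_left, real_inner_smul_right, hin]
    rw [orthonormal_iff_ite.1 q.orthonormal k l]
    by_cases e : k = l
    · subst e
      simp only [if_true]
      field_simp
    · simp [e]

/-- Bessel's inequality for a family that is orthonormal up to zero vectors. -/
theorem sum_sq_inner_le {ι F : Type*} [Fintype ι] [NormedAddCommGroup F] [InnerProductSpace ℝ F]
    (P : ι → Prop) {p : ι → F} (h0 : ∀ k, ¬ P k → p k = 0)
    (h : Orthonormal ℝ fun k : {k // P k} => p k) (u : F) :
    ∑ k, (inner ℝ (p k) u) ^ 2 ≤ ‖u‖ ^ 2 := by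
  classical
  have h1 := h.sum_inner_products_le (s := Finset.univ) u
  refine le_trans (le_of_eq ?_) h1
  rw [← Finset.sum_filter_add_sum_filter_not Finset.univ P,
    Finset.sum_eq_zero (s := Finset.univ.filter fun k => ¬ P k), add_zero,
    Finset.sum_subtype (p := P) (F := inferInstance) _ (by simp)]
  · simp
  · intro k hk
    simp [h0 k (Finset.mem_filter.1 hk).2]

/-- The total squared length of the projections of an orthonormal basis to a subspace. -/
theorem sum_norm_sq_starProjection {ι E : Type*} [Fintype ι] [NormedAddCommGroup E]
    [InnerProductSpace ℝ E] [FiniteDimensional ℝ E] (q : OrthonormalBasis ι ℝ E)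
    (K : Submodule ℝ E) : ∑ k, ‖K.starProjection (q k)‖ ^ 2 = Module.finrank ℝ K := by
  set b := stdOrthonormalBasis ℝ K
  have h : ∀ v : E, ‖K.starProjection v‖ ^ 2 = ∑ l, (inner ℝ ((b l : K) : E) v) ^ 2 := by
    intro v
    rw [Submodule.starProjection_apply, ← Submodule.coe_norm, ← b.sum_sq_norm_inner_right]
    refine Finset.sum_congr rfl fun l _ => ?_
    rw [Submodule.inner_orthogonalProjectionOnto_eq_of_mem_left, Real.norm_eq_abs, sq_abs]
  simp_rw [h]
  rw [Finset.sum_comm]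
  have h2 : ∀ l, ∑ k, (inner ℝ ((b l : K) : E) (q k)) ^ 2 = 1 := by
    intro l
    have := q.sum_sq_norm_inner_left ((b l : K) : E)
    simp only [Real.norm_eq_abs, sq_abs] at this
    rw [this, ← Submodule.coe_norm, b.orthonormal.1 l, one_pow]
  simp [h2]

/-- Removing total weight `N` from a decreasing sum leaves at least the tail from `N` on. -/
theorem sum_tail_le {n : ℕ} {s : ℕ → ℝ} (hs : Antitone s) (h0 : ∀ k, 0 ≤ s k) (d : Fin n → ℝ)
    (hd0 : ∀ k, 0 ≤ d k) (hd1 : ∀ k, d k ≤ 1) {N : ℕ} (hd : ∑ k, d k ≤ N) :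
    ∑ k : Fin n, (if N ≤ (k : ℕ) then s k else 0) ≤ ∑ k : Fin n, s k * (1 - d k) := by
  rcases le_total n N with hnN | hNn
  · refine Finset.sum_le_sum fun k _ => ?_
    rw [if_neg (by omega)]
    exact mul_nonneg (h0 _) (by linarith [hd1 k])
  -- Compare with the threshold value `s N`: moving weight from index `k` to the first `N` indices
  -- has the right sign, as `s k ≥ s N` before `N` and `s k ≤ s N` after.
  · have h1 : ∀ k : Fin n, s N * ((if (k : ℕ) < N then 1 else 0) - d k) ≤
        s k * (1 - d k) - (if N ≤ (k : ℕ) then s k else 0) := by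
      intro k
      by_cases h : (k : ℕ) < N
      · rw [if_pos h, if_neg (by omega), sub_zero]
        exact mul_le_mul_of_nonneg_right (hs h.le) (by linarith [hd1 k])
      · rw [if_neg h, if_pos (by omega)]
        nlinarith [hs (not_lt.1 h), hd0 k]
    have h2 := Finset.sum_le_sum fun k (_ : k ∈ Finset.univ) => h1 k
    rw [← Finset.mul_sum, Finset.sum_sub_distrib, Finset.sum_sub_distrib] at h2
    have h3 : ∑ k : Fin n, (if (k : ℕ) < N then (1 : ℝ) else 0) = N := by
      rw [Fin.sum_univ_eq_sum_range (fun k => if k < N then (1 : ℝ) else 0), ← Finset.sum_filter,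
        Finset.sum_const]
      have : (Finset.range n).filter (· < N) = Finset.range N := by ext; simp; omega
      simp [this]
    rw [h3] at h2
    have := mul_nonneg (h0 N) (sub_nonneg.2 hd)
    linarith

/-- The Frobenius pairing of `∑ pₖ wₖᵀ` with `X` is `∑ ⟨pₖ, X wₖ⟩`; it serves for `X = u vᵀ` and for
`X = H`. -/
theorem sum_sum_sum_mul {m n r : ℕ} (p : Fin r → Fin m → ℝ) (w : Fin r → Fin n → ℝ)
    (X : Fin m → Fin n → ℝ) :
    ∑ i, ∑ j, (∑ k, p k i * w k j) * X i j = ∑ k, ∑ i, p k i * ∑ j, X i j * w k j := by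
  simp_rw [Finset.sum_mul, Finset.mul_sum]
  rw [Finset.sum_congr rfl fun i _ => Finset.sum_comm, Finset.sum_comm]
  exact Finset.sum_congr rfl fun k _ => Finset.sum_congr rfl fun i _ =>
    Finset.sum_congr rfl fun j _ => by ring

/-- A contraction that annihilates `K` and pairs with `H` to at least the tail of the sum of the
singular values of `H` from the dimension of `K` on. -/
theorem exists_contraction {m n : ℕ} (H : Matrix (Fin m) (Fin n) ℝ)
    (K : Submodule ℝ (EuclideanSpace ℝ (Fin n))) {N : ℕ} (hK : Module.finrank ℝ K ≤ N) :
    ∃ C : Matrix (Fin m) (Fin n) ℝ,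
      (∀ (u : EuclideanSpace ℝ (Fin m)) (v : EuclideanSpace ℝ (Fin n)),
        ∑ i, ∑ j, C i j * (u i * v j) ≤ ‖u‖ * ‖v‖) ∧
      (∀ (u : EuclideanSpace ℝ (Fin m)), ∀ v ∈ K, ∑ i, ∑ j, C i j * (u i * v j) = 0) ∧
      ∑ k : Fin n, (if N ≤ (k : ℕ) then (Matrix.toEuclideanLin H).singularValues k else 0) ≤
        ∑ i, ∑ j, C i j * H i j := by
  set T := Matrix.toEuclideanLin H with hT
  obtain ⟨q, p, -, hpT, hp0, hp⟩ := exists_singular_basis finrank_euclideanSpace_fin T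
  set w : Fin n → EuclideanSpace ℝ (Fin n) := fun k => q k - K.starProjection (q k) with hw
  have hwv : ∀ k v, inner ℝ (w k) v = inner ℝ (q k) (v - K.starProjection v) := by
    intro k v
    rw [hw, inner_sub_left, inner_sub_right, Submodule.inner_starProjection_left_eq_right]
  have hpair : ∀ (u : EuclideanSpace ℝ (Fin m)) (v : EuclideanSpace ℝ (Fin n)),
      ∑ i, ∑ j, (∑ k, p k i * w k j) * (u i * v j) =
        ∑ k, inner ℝ (p k) u * inner ℝ (q k) (v - K.starProjection v) := by
    intro u v
    rw [sum_sum_sum_mul (fun k => p k) (fun k => w k)]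
    refine Finset.sum_congr rfl fun k _ => ?_
    rw [← hwv]
    simp only [PiLp.inner_apply, RCLike.inner_apply, conj_trivial]
    simp_rw [Finset.sum_mul, mul_assoc, ← Finset.mul_sum]
    exact Finset.sum_congr rfl fun i _ => by ring
  -- This is `C = W (1 - P)`, with `W = ∑ pₖ qₖᵀ` the partial isometry of the polar decomposition of
  -- `H` and `P` the projection to `K`.
  refine ⟨fun i j => ∑ k, p k i * w k j, ?_, ?_, ?_⟩
  · intro u v
    rw [hpair]
    -- Cauchy-Schwarz, then Bessel for the `pₖ` and Parseval for the `qₖ`.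
    refine (Real.sum_mul_le_sqrt_mul_sqrt _ _ _).trans ?_
    have h1 := sum_sq_inner_le (fun k : Fin n => T.singularValues k ≠ 0) (fun k hk => hp0 k (not_not.1 hk))
      hp u
    have h2 := q.sum_sq_norm_inner_right (v - K.starProjection v)
    simp only [Real.norm_eq_abs, sq_abs] at h2
    rw [h2]
    refine mul_le_mul ((Real.sqrt_le_sqrt h1).trans_eq (Real.sqrt_sq (norm_nonneg _))) ?_
      (Real.sqrt_nonneg _) (norm_nonneg _)
    have h3 : v - K.starProjection v = Kᗮ.starProjection v := by
      rw [Submodule.starProjection_orthogonal]; rfl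
    rw [Real.sqrt_sq (norm_nonneg _), h3]
    exact Submodule.norm_starProjection_apply_le _ _
  · intro u v hv
    rw [hpair, Submodule.starProjection_eq_self_iff.2 hv]
    simp
  · have h1 : ∑ i, ∑ j, (∑ k, p k i * w k j) * H i j =
        ∑ k : Fin n, T.singularValues k * (1 - ‖K.starProjection (q k)‖ ^ 2) := by
      have hPP : ∀ v, inner ℝ v (K.starProjection v) = ‖K.starProjection v‖ ^ 2 := fun v => by
        rw [real_inner_comm]
        exact K.re_inner_starProjection_eq_normSq v
      have h2 : ∀ k, inner ℝ (p k) (T (w k)) =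
          T.singularValues k * (1 - ‖K.starProjection (q k)‖ ^ 2) := by
        intro k
        rw [hpT, hw, inner_sub_right, real_inner_self_eq_norm_sq, q.orthonormal.1 k,
          hPP]
        norm_num
      refine (sum_sum_sum_mul (fun k => p k) (fun k => w k) fun i j => H i j).trans ?_
      refine Finset.sum_congr rfl fun k _ => ?_
      rw [← h2]
      simp only [PiLp.inner_apply, RCLike.inner_apply, conj_trivial, hT,
        Matrix.toLpLin_apply, Matrix.mulVec, dotProduct]
      exact Finset.sum_congr rfl fun i _ => by ring
    rw [h1]
    -- The removed weights `‖P qₖ‖²` lie in `[0, 1]` and add up to the dimension of `K`.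
    refine sum_tail_le T.singularValues_antitone T.singularValues_nonneg _ (fun k => by positivity)
      (fun k => ?_) ?_
    · have := Submodule.norm_starProjection_apply_le K (q k)
      rw [q.orthonormal.1 k] at this
      exact pow_le_one₀ (norm_nonneg _) this
    · rw [sum_norm_sq_starProjection]
      exact_mod_cast hK

/-- The frequency of mode `l` counts the even thresholds `2t ≤ l`, since each frequency carries two
modes. -/
theorem sum_range_indicator (N l : ℕ) :
    ∑ t ∈ Finset.range N, (if 2 * t ≤ l then (1 : ℝ) else 0) = (min N (freq l) : ℕ) := by
  rw [← Finset.sum_filter, Finset.sum_const, nsmul_eq_mul, mul_one]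
  congr 1
  have : (Finset.range N).filter (fun t => 2 * t ≤ l) = Finset.range (min N (freq l)) := by
    ext t; simp only [Finset.mem_filter, Finset.mem_range, freq]; omega
  rw [this, Finset.card_range]

/-! ### The lower bound -/

/-- The weighted sum of singular values is at most the total norm of the factors. -/
theorem weighted_sum_singularValues_le {m n : ℕ} (H : Matrix (Fin m) (Fin n) ℝ)
    (u : ℕ → EuclideanSpace ℝ (Fin m)) (v : ℕ → EuclideanSpace ℝ (Fin n))
    (hH : ∀ i j, HasSum (fun l => 1 / (Real.pi * freq l) * (u l i * v l j)) (H i j))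
    {S : ℝ} (hS : HasSum (fun l => ‖u l‖ * ‖v l‖) S) :
    Real.pi * ∑ k : Fin n, freq k * (Matrix.toEuclideanLin H).singularValues k ≤ S := by
  have hK : ∀ t : ℕ, Module.finrank ℝ
      (Submodule.span ℝ (Set.range fun l : Fin (2 * t) => v l)) ≤ 2 * t := fun t => by
    exact (finrank_range_le_card (R := ℝ) fun l : Fin (2 * t) => v l).trans_eq (by simp)
  choose C hC1 hC2 hC3 using fun t => exists_contraction H _ (hK t)
  have h1 : ∀ t, HasSum (fun l => ∑ i, ∑ j, C t i j * (1 / (Real.pi * freq l) * (u l i * v l j)))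
      (∑ i, ∑ j, C t i j * H i j) := fun t =>
    hasSum_sum fun i _ => hasSum_sum fun j _ => (hH i j).mul_left _
  have h2 : ∀ t l, ∑ i, ∑ j, C t i j * (1 / (Real.pi * freq l) * (u l i * v l j)) ≤
      1 / (Real.pi * freq l) * (‖u l‖ * ‖v l‖) * (if 2 * t ≤ l then 1 else 0) := by
    intro t l
    have hpos : 0 ≤ 1 / (Real.pi * freq l) := by
      have := freq_pos l; have := Real.pi_pos; positivity
    have e : ∑ i, ∑ j, C t i j * (1 / (Real.pi * freq l) * (u l i * v l j)) =
        1 / (Real.pi * freq l) * ∑ i, ∑ j, C t i j * (u l i * v l j) := by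
      simp_rw [Finset.mul_sum]
      exact Finset.sum_congr rfl fun i _ => Finset.sum_congr rfl fun j _ => by ring
    rw [e]
    split_ifs with h
    · rw [mul_one]
      exact mul_le_mul_of_nonneg_left (hC1 t _ _) hpos
    · rw [hC2 t (u l) (v l) (Submodule.subset_span ⟨⟨l, by omega⟩, rfl⟩), mul_zero, mul_zero]
  -- Only `t < n` is used. For large `l` this undercounts the frequency, which is harmless here; for
  -- singular value indices `k < n` the count is exact, as `freq k ≤ n`.
  have h3 : ∑ t ∈ Finset.range n, ∑ i, ∑ j, C t i j * H i j ≤ 1 / Real.pi * S := by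
    refine hasSum_le (fun l => ?_) (hasSum_sum fun t _ => h1 t) (hS.mul_left (1 / Real.pi))
    refine (Finset.sum_le_sum fun t _ => h2 t l).trans ?_
    rw [← Finset.mul_sum, sum_range_indicator]
    have h4 : ((min n (freq l) : ℕ) : ℝ) ≤ freq l := by exact_mod_cast min_le_right _ _
    have h5 := freq_pos l
    have h6 := Real.pi_pos
    calc 1 / (Real.pi * freq l) * (‖u l‖ * ‖v l‖) * ((min n (freq l) : ℕ) : ℝ)
        ≤ 1 / (Real.pi * freq l) * (‖u l‖ * ‖v l‖) * freq l :=
          mul_le_mul_of_nonneg_left h4 (by positivity)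
      _ = 1 / Real.pi * (‖u l‖ * ‖v l‖) := by field_simp
  have h4 := (Finset.sum_le_sum fun t (_ : t ∈ Finset.range n) => hC3 t).trans h3
  rw [Finset.sum_comm] at h4
  have h5 : ∀ k : Fin n, ∑ t ∈ Finset.range n,
      (if 2 * t ≤ (k : ℕ) then (Matrix.toEuclideanLin H).singularValues k else 0) =
      freq k * (Matrix.toEuclideanLin H).singularValues k := by
    intro k
    have : min n (freq k) = freq k := by have := k.2; unfold freq; omega
    rw [← this, ← sum_range_indicator, Finset.sum_mul]
    exact Finset.sum_congr rfl fun t _ => by split_ifs <;> simp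
  simp_rw [h5] at h4
  have h6 := Real.pi_pos
  rw [one_div, ← div_eq_inv_mul, le_div_iff₀ h6] at h4
  linarith

/-- `partner` as a permutation. -/
def partnerPerm : Equiv.Perm ℕ := Function.Involutive.toPerm partner partner_partner

/-- The difference of the two sides is `(a/√m - b/√n)²`. -/
theorem two_div_sqrt_mul_le {m n : ℕ} (hm : 0 < m) (hn : 0 < n) (a b : ℝ) :
    2 / √((m : ℝ) * n) * (a * b) ≤ 1 / (m : ℝ) * a ^ 2 + 1 / (n : ℝ) * b ^ 2 := by
  have hm' : 0 < √(m : ℝ) := Real.sqrt_pos.2 (by exact_mod_cast hm)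
  have hn' : 0 < √(n : ℝ) := Real.sqrt_pos.2 (by exact_mod_cast hn)
  rw [Real.sqrt_mul (Nat.cast_nonneg m)]
  have e : 1 / (m : ℝ) * a ^ 2 + 1 / (n : ℝ) * b ^ 2 - 2 / (√(m : ℝ) * √(n : ℝ)) * (a * b) =
      (a / √(m : ℝ) - b / √(n : ℝ)) ^ 2 := by
    rw [sub_sq, div_pow, div_pow, Real.sq_sqrt (Nat.cast_nonneg m),
      Real.sq_sqrt (Nat.cast_nonneg n)]
    field_simp
    ring
  nlinarith [sq_nonneg (a / √(m : ℝ) - b / √(n : ℝ))]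

theorem le_controlCost {m n : ℕ} (hm : 0 < m) (hn : 0 < n) (H : Matrix (Fin m) (Fin n) ℝ)
    {U : Fin m → L2} {V : Fin n → L2} (hU : ∀ i, U i ∈ admissible) (hV : ∀ j, V j ∈ admissible)
    (hR : Realizes U V H) :
    2 * Real.pi / √((m : ℝ) * n) *
      ∑ k : Fin n, freq k * (Matrix.toEuclideanLin H).singularValues k ≤ controlCost U V := by
  choose a _ ha using hU
  choose b _ hb using hV
  -- The sign and the sine-cosine swap are absorbed into `u`; neither changes the total energy.
  set u : ℕ → EuclideanSpace ℝ (Fin m) := fun l =>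
    WithLp.toLp 2 fun i => derivSign l * a i (partner l) with hu
  set v : ℕ → EuclideanSpace ℝ (Fin n) := fun l => WithLp.toLp 2 fun j => b j l with hv
  have hH : ∀ i j, HasSum (fun l => 1 / (Real.pi * freq l) * (u l i * v l j)) (H i j) := by
    intro i j
    obtain ⟨x, y, z, h, hz⟩ := hR i j
    rw [← hz]
    exact h.hasSum_output (ha i) (hb j)
  have hA : HasSum (fun l => ‖u l‖ ^ 2) (∑ i, ∫ t in (0 : ℝ)..1, (U i t) ^ 2) := by
    have h := hasSum_sum fun i (_ : i ∈ Finset.univ) => hasSum_energy (ha i)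
    rw [← partnerPerm.hasSum_iff] at h
    refine h.congr_fun fun l => ?_
    rw [EuclideanSpace.norm_sq_eq]
    refine Finset.sum_congr rfl fun i _ => ?_
    simp only [hu, Real.norm_eq_abs, sq_abs, mul_pow, derivSign_sq, one_mul]
    rfl
  have hB : HasSum (fun l => ‖v l‖ ^ 2) (∑ j, ∫ t in (0 : ℝ)..1, (V j t) ^ 2) := by
    refine (hasSum_sum fun j (_ : j ∈ Finset.univ) => hasSum_energy (hb j)).congr_fun fun l => ?_
    rw [EuclideanSpace.norm_sq_eq]
    simp only [hv, Real.norm_eq_abs, sq_abs]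
  have hcost := (hA.mul_left (1 / (m : ℝ))).add (hB.mul_left (1 / (n : ℝ)))
  have hsum : Summable fun l => ‖u l‖ * ‖v l‖ := by
    refine Summable.of_nonneg_of_le (fun l => by positivity) (fun l => ?_)
      (hA.summable.add hB.summable)
    nlinarith [sq_nonneg (‖u l‖ - ‖v l‖), sq_nonneg (‖u l‖ + ‖v l‖)]
  have h1 := hasSum_le (fun l => two_div_sqrt_mul_le hm hn ‖u l‖ ‖v l‖)
    (hsum.hasSum.mul_left _) hcost
  have h2 := weighted_sum_singularValues_le H u v hH hsum.hasSum
  refine le_trans ?_ h1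
  have h3 : 0 ≤ 2 / √((m : ℝ) * n) := by positivity
  have h4 := mul_le_mul_of_nonneg_left h2 h3
  refine le_trans (le_of_eq ?_) h4
  ring

/-! ### Optimal controls -/

theorem hasSum_range_smul {A : ℕ → ℝ} {n : ℕ} (hA : ∀ k, n ≤ k → A k = 0) :
    HasSum (fun k => A k • trigBasis k) (∑ k ∈ Finset.range n, A k • trigBasis k) :=
  hasSum_sum_of_ne_finset_zero fun k hk => by
    rw [hA k (by simpa using hk), zero_smul]

theorem hasSum_range_smul_partner {A : ℕ → ℝ} {n : ℕ} (hA : ∀ k, n ≤ k → A k = 0) :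
    HasSum (fun k => A (partner k) • trigBasis k)
      (∑ k ∈ Finset.range n, A k • trigBasis (partner k)) := by
  rw [← partnerPerm.hasSum_iff]
  have h : HasSum (fun k => A k • trigBasis (partner k))
      (∑ k ∈ Finset.range n, A k • trigBasis (partner k)) :=
    hasSum_sum_of_ne_finset_zero fun k hk => by rw [hA k (by simpa using hk), zero_smul]
  refine h.congr_fun fun k => ?_
  change A (partner (partner k)) • trigBasis (partner k) = _
  rw [partner_partner]

theorem exists_optimal {m n : ℕ} (hm : 0 < m) (hn : 0 < n) (H : Matrix (Fin m) (Fin n) ℝ) :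
    ∃ (U : Fin m → L2) (V : Fin n → L2),
      (∀ i, U i ∈ admissible) ∧ (∀ j, V j ∈ admissible) ∧
      (∀ i, U i ∈ Submodule.span ℝ (Set.range trigBasis)) ∧
      (∀ j, V j ∈ Submodule.span ℝ (Set.range trigBasis)) ∧
      Realizes U V H ∧
      controlCost U V = 2 * Real.pi / √((m : ℝ) * n) *
        ∑ k : Fin n, freq k * (Matrix.toEuclideanLin H).singularValues k := by
  set T := Matrix.toEuclideanLin H with hT
  obtain ⟨q, p, hTq, -, hp0, hp⟩ := exists_singular_basis finrank_euclideanSpace_fin T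
  -- `p k` is either a unit vector or zero with `σₖ = 0`, so its norm never matters next to `σₖ`.
  have hpn : ∀ k : Fin n, T.singularValues k * ‖p k‖ ^ 2 = T.singularValues k := by
    intro k
    by_cases h : T.singularValues k = 0
    · rw [h, zero_mul]
    · rw [hp.1 ⟨k, h⟩, one_pow, mul_one]
  have hHpq : ∀ i j, H i j = ∑ k : Fin n, T.singularValues k * (p k i * q k j) := by
    intro i j
    have h1 : T (EuclideanSpace.single j 1) i = H i j := by
      simp [hT, Matrix.toLpLin_apply]
    rw [← h1, ← q.sum_repr (EuclideanSpace.single j 1), map_sum]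
    simp only [map_smul, hTq, q.repr_apply_apply, EuclideanSpace.inner_single_right, conj_trivial,
      one_mul, WithLp.ofLp_sum, Finset.sum_apply, PiLp.smul_apply, smul_eq_mul]
    exact Finset.sum_congr rfl fun k _ => by ring
  -- The product of the two amplitudes at mode `k` must be `π fₖ σₖ` to cancel the weight `1/(π
  -- fₖ)`.
  set α : ℕ → ℝ := fun k => √(Real.pi * freq k * T.singularValues k) with hα
  have hα2 : ∀ k, α k ^ 2 = Real.pi * freq k * T.singularValues k := fun k =>
    Real.sq_sqrt (mul_nonneg (mul_nonneg Real.pi_pos.le (freq_pos k).le)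
      (T.singularValues_nonneg k))
  have hm' : 0 < √(m : ℝ) := Real.sqrt_pos.2 (by exact_mod_cast hm)
  have hn' : 0 < √(n : ℝ) := Real.sqrt_pos.2 (by exact_mod_cast hn)
  -- Equality in AM-GM: `c²/m = c⁻²/n = 1/√(mn)`.
  set c : ℝ := √(√(m : ℝ) / √(n : ℝ)) with hc
  have hcpos : 0 < c := Real.sqrt_pos.2 (div_pos hm' hn')
  have hc2 : c ^ 2 = √(m : ℝ) / √(n : ℝ) := Real.sq_sqrt (div_pos hm' hn').le
  -- The coefficient `P i k` is placed on mode `partner k`, where it couples to mode `k` of the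
  -- other control; the factor `derivSign k` cancels the sign of that coupling.
  set P : Fin m → ℕ → ℝ := fun i k => if h : k < n then c * α k * derivSign k * p ⟨k, h⟩ i else 0
    with hP
  set Q : Fin n → ℕ → ℝ := fun j k => if h : k < n then c⁻¹ * α k * q ⟨k, h⟩ j else 0 with hQ
  have hPk : ∀ i (k : Fin n), P i k = c * α k * derivSign k * p k i := fun i k => by simp [hP]
  have hQk : ∀ j (k : Fin n), Q j k = c⁻¹ * α k * q k j := fun j k => by simp [hQ]
  have hP0 : ∀ i k, n ≤ k → P i k = 0 := fun i k hk => by simp [hP, hk]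
  have hQ0 : ∀ j k, n ≤ k → Q j k = 0 := fun j k hk => by simp [hQ, hk]
  have hUs := fun i => hasSum_range_smul_partner (hP0 i)
  have hVs := fun j => hasSum_range_smul (hQ0 j)
  refine ⟨_, _, fun i => ⟨_, (hasSum_energy (hUs i)).summable, hUs i⟩,
    fun j => ⟨_, (hasSum_energy (hVs j)).summable, hVs j⟩, ?_, ?_, ?_, ?_⟩
  · exact fun i => Submodule.sum_mem _ fun k _ =>
      Submodule.smul_mem _ _ (Submodule.subset_span ⟨_, rfl⟩)
  · exact fun j => Submodule.sum_mem _ fun k _ =>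
      Submodule.smul_mem _ _ (Submodule.subset_span ⟨_, rfl⟩)
  · intro i j
    obtain ⟨x, y, z, h⟩ := exists_isTrajectory (∑ k ∈ Finset.range n, P i k • trigBasis (partner k))
      (∑ k ∈ Finset.range n, Q j k • trigBasis k)
    refine ⟨x, y, z, h, ?_⟩
    have h1 := h.hasSum_output (hUs i) (hVs j)
    simp only [partner_partner] at h1
    have h2 := h1.unique (hasSum_sum_of_ne_finset_zero (s := Finset.range n) fun k hk => by
      rw [hQ0 j k (by simpa using hk), mul_zero, mul_zero])
    rw [h2, hHpq, Finset.sum_range]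
    refine Finset.sum_congr rfl fun k _ => ?_
    rw [hPk, hQk]
    have h3 := freq_pos k
    have h4 := Real.pi_pos
    have h5 := hα2 k
    have h6 := derivSign_sq k
    calc 1 / (Real.pi * freq k) * (derivSign k * (c * α k * derivSign k * p k i) *
          (c⁻¹ * α k * q k j))
        = 1 / (Real.pi * freq k) * (derivSign k ^ 2 * α k ^ 2 * (c * c⁻¹) * (p k i * q k j)) := by
          ring
      _ = T.singularValues k * (p k i * q k j) := by
          rw [h5, h6, mul_inv_cancel₀ hcpos.ne']
          field_simp
  · have hEU : ∀ i, ∫ t in (0 : ℝ)..1,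
        ((∑ k ∈ Finset.range n, P i k • trigBasis (partner k) : L2) t) ^ 2 =
          ∑ k : Fin n, P i k ^ 2 := by
      intro i
      have h1 := hasSum_energy (hUs i)
      rw [← partnerPerm.hasSum_iff] at h1
      have h2 : HasSum (fun k => P i k ^ 2) (∑ k ∈ Finset.range n, P i k ^ 2) :=
        hasSum_sum_of_ne_finset_zero fun k hk => by
          rw [hP0 i k (by simpa using hk), zero_pow two_ne_zero]
      rw [Finset.sum_range] at h2
      refine h1.unique (h2.congr_fun fun k => ?_)
      change P i (partner (partner k)) ^ 2 = _
      rw [partner_partner]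
    have hEV : ∀ j, ∫ t in (0 : ℝ)..1,
        ((∑ k ∈ Finset.range n, Q j k • trigBasis k : L2) t) ^ 2 = ∑ k : Fin n, Q j k ^ 2 := by
      intro j
      have h2 : HasSum (fun k => Q j k ^ 2) (∑ k ∈ Finset.range n, Q j k ^ 2) :=
        hasSum_sum_of_ne_finset_zero fun k hk => by
          rw [hQ0 j k (by simpa using hk), zero_pow two_ne_zero]
      rw [Finset.sum_range] at h2
      exact (hasSum_energy (hVs j)).unique h2
    have hA : ∑ i, ∑ k : Fin n, P i k ^ 2 =
        c ^ 2 * (Real.pi * ∑ k : Fin n, freq k * T.singularValues k) := by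
      rw [Finset.sum_comm, Finset.mul_sum, Finset.mul_sum]
      refine Finset.sum_congr rfl fun k _ => ?_
      have : ∑ i, P i k ^ 2 = c ^ 2 * α k ^ 2 * derivSign k ^ 2 * ‖p k‖ ^ 2 := by
        simp_rw [hPk, EuclideanSpace.norm_sq_eq, Real.norm_eq_abs, sq_abs, mul_pow, Finset.mul_sum]
      rw [this, hα2, derivSign_sq]
      linear_combination (c ^ 2 * Real.pi * freq k) * hpn k
    have hB : ∑ j, ∑ k : Fin n, Q j k ^ 2 =
        (c ^ 2)⁻¹ * (Real.pi * ∑ k : Fin n, freq k * T.singularValues k) := by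
      rw [Finset.sum_comm, Finset.mul_sum, Finset.mul_sum]
      refine Finset.sum_congr rfl fun k _ => ?_
      have : ∑ j, Q j k ^ 2 = (c ^ 2)⁻¹ * α k ^ 2 * ‖q k‖ ^ 2 := by
        simp_rw [hQk, EuclideanSpace.norm_sq_eq, Real.norm_eq_abs, sq_abs, mul_pow, inv_pow,
          Finset.mul_sum]
      rw [this, hα2, q.orthonormal.1 k]
      ring
    simp only [controlCost, hEU, hEV, hA, hB, hc2]
    have hmm : 1 / (m : ℝ) = 1 / (√(m : ℝ) * √(m : ℝ)) := by
      rw [Real.mul_self_sqrt (Nat.cast_nonneg m)]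
    have hnn : 1 / (n : ℝ) = 1 / (√(n : ℝ) * √(n : ℝ)) := by
      rw [Real.mul_self_sqrt (Nat.cast_nonneg n)]
    rw [Real.sqrt_mul (Nat.cast_nonneg m), hmm, hnn]
    field_simp
    ring

/-! ### Matching the indexing of the statement -/

theorem ceil_succ_div_two (k : ℕ) : ⌈((k + 1 : ℕ) : ℝ) / 2⌉₊ = freq k := by
  rw [Nat.ceil_eq_iff (by simp [freq])]
  have h1 : 2 * (k / 2) < k + 1 := by omega
  have h2 : k + 1 ≤ 2 * (k / 2 + 1) := by omega
  have h1' : 2 * ((k / 2 : ℕ) : ℝ) < ((k + 1 : ℕ) : ℝ) := by exact_mod_cast h1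
  have h2' : ((k + 1 : ℕ) : ℝ) ≤ 2 * ((k / 2 + 1 : ℕ) : ℝ) := by exact_mod_cast h2
  simp only [freq, Nat.add_sub_cancel]
  constructor <;> linarith

theorem sum_ceil_mul_sigma {m n : ℕ} (H : Matrix (Fin m) (Fin n) ℝ) :
    ∑ k ∈ Finset.Icc 1 (min m n), (⌈(k : ℝ) / 2⌉₊ : ℝ) * sigma H k =
      ∑ k : Fin n, freq k * (Matrix.toEuclideanLin H).singularValues k := by
  rw [← Finset.sum_range (fun k => (freq k : ℝ) * (Matrix.toEuclideanLin H).singularValues k)]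
  have h1 : ∑ k ∈ Finset.Icc 1 (min m n), (⌈(k : ℝ) / 2⌉₊ : ℝ) * sigma H k =
      ∑ k ∈ Finset.range (min m n), freq k * (Matrix.toEuclideanLin H).singularValues k := by
    refine Finset.sum_nbij' (fun k => k - 1) (fun k => k + 1) ?_ ?_ ?_ ?_ ?_
    · intro k hk; simp only [Finset.mem_Icc, Finset.mem_range] at *; omega
    · intro k hk; simp only [Finset.mem_Icc, Finset.mem_range] at *; omega
    · intro k hk; simp only [Finset.mem_Icc] at hk; omega
    · intro k _; omega
    · intro k hk
      simp only [Finset.mem_Icc] at hk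
      rw [← ceil_succ_div_two, Nat.sub_add_cancel hk.1]
      rfl
  rw [h1]
  -- The terms with `m ≤ k < n` vanish, because the rank of `H` is at most `m`.
  refine Finset.sum_subset (Finset.range_mono (min_le_right _ _)) fun k hk hk' => ?_
  simp only [Finset.mem_range] at hk hk'
  have h2 : Module.finrank ℝ (LinearMap.range (Matrix.toEuclideanLin H)) ≤ m :=
    (Submodule.finrank_le _).trans_eq finrank_euclideanSpace_fin
  rw [(Matrix.toEuclideanLin H).singularValues_eq_zero_iff_le_finrank_range.2 (by omega), mul_zero]

end BrockettHeisenberg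

theorem corollary5p1 {m n : ℕ} (hm : 0 < m) (hn : 0 < n) (H : Matrix (Fin m) (Fin n) ℝ) :
    IsLeast (BrockettHeisenberg.costSet H)
      (2 * Real.pi / √((m : ℝ) * n) *
        ∑ k ∈ Finset.Icc 1 (min m n), (⌈(k : ℝ) / 2⌉₊ : ℝ) * BrockettHeisenberg.sigma H k) ∧
    ∃ (U : Fin m → BrockettHeisenberg.L2) (V : Fin n → BrockettHeisenberg.L2),
      (∀ i, U i ∈ Submodule.span ℝ (Set.range BrockettHeisenberg.trigBasis)) ∧
      (∀ j, V j ∈ Submodule.span ℝ (Set.range BrockettHeisenberg.trigBasis)) ∧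
      BrockettHeisenberg.Realizes U V H ∧
      BrockettHeisenberg.controlCost U V =
        2 * Real.pi / √((m : ℝ) * n) *
          ∑ k ∈ Finset.Icc 1 (min m n), (⌈(k : ℝ) / 2⌉₊ : ℝ) * BrockettHeisenberg.sigma H k := by
  rw [BrockettHeisenberg.sum_ceil_mul_sigma]
  obtain ⟨U, V, hU, hV, hUs, hVs, hR, hcost⟩ := BrockettHeisenberg.exists_optimal hm hn H
  refine ⟨⟨⟨U, V, hU, hV, hR, hcost.symm⟩, ?_⟩, U, V, hUs, hVs, hR, hcost⟩
  rintro _ ⟨U', V', hU', hV', hR', rfl⟩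
  exact BrockettHeisenberg.le_controlCost hm hn H hU' hV' hR'
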